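/- Fix finitely many agents $1,\dots,h$ with $h\ge 1$ and a nonempty set of propositions. Formulas are given by $A ::= p \mid \neg p \mid (A\vee A)\mid (A\wedge A)\mid \Diamond_i A\mid \Box_i A\mid \Diamond^{*} A\mid \Box^{*} A$ with $1\le i\le h$, where $\Box^{*}$ is read "common knowledge" and $\Diamond^{*}$ is its dual. Binary connectives associate to the left. Put $\Box A=\Box_1A\wedge\dots\wedge\Box_hA$ and $\Diamond A=\Diamond_1A\vee\dots\vee\Diamond_hA$; $\Box^kA$, $\Diamond^kA$ are the $k$-fold iterates. Let $\bot=p_0\wedge\neg p_0$ for a fixed proposition $p_0$. A shallow sequent is a finite multiset of formulas. The cut-free shallow system $G_C$ has the axioms $\Gamma,p,\neg p$ and the rules (premises $\Rightarrow$ conclusion) - $\Gamma,A$ and $\Gamma,B\ \Rightarrow\ \Gamma,A\wedge B$; - $\Gamma,A,B\ \Rightarrow\ \Gamma,A\vee B$; - $\Gamma,\Diamond^{*}\Delta,A\ \Rightarrow\ \Diamond_i\Gamma,\Diamond^{*}\Delta,\Box_iA,\Sigma$; - $\Gamma,\Box^kA$ for all $k\ge1\ \Rightarrow\ \Gamma,\Box^{*}A$;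 - $\Gamma,\Diamond^{*}A,\Diamond A\ \Rightarrow\ \Gamma,\Diamond^{*}A$. A nested sequent is a finite multiset of formulas and boxed sequents $[\Delta]_i$, where $\Delta$ is a nested sequent and $1\le i\le h$. A context $\Gamma\{\ \}$ is a nested sequent with one hole, not inside a formula, and $\Gamma\{\Delta\}$ is obtained by putting $\Delta$ into the hole. The cut-free nested system $D_C$ has the axioms $\Gamma\{p,\neg p\}$ and the rules - $\Gamma\{A\}$ and $\Gamma\{B\}\ \Rightarrow\ \Gamma\{A\wedge B\}$; - $\Gamma\{A,B\}\ \Rightarrow\ \Gamma\{A\vee B\}$; - $\Gamma\{[A]_i\}\ \Rightarrow\ \Gamma\{\Box_iA\}$; - $\Gamma\{\Diamond_iA,[\Delta,A]_i\}\ \Rightarrow\ \Gamma\{\Diamond_iA,[\Delta]_i\}$; - $\Gamma\{\Box^kA\}$ for all $k\ge1\ \Rightarrow\ \Gamma\{\Box^{*}A\}$; - $\Gamma\{\Diamond^{*}A,\Diamond^kA\}\ \Rightarrow\ \Gamma\{\Diamond^{*}A\}$, for each $k\ge 1$. Proofs are well-founded, possibly infinitely branching trees. The depth of an axiom is $0$,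 and the depth of any other proof is $\sup_j(\delta_j+1)$, where $\delta_j$ are the depths of its immediate subproofs. Fix arbitrary linear orders on formulas and on boxed sequents. The formula $\underline{\Gamma}_{\mathsf F}$ corresponding to a nested sequent $\Gamma=A_1,\dots,A_m,[\Delta_1]_{i_1},\dots,[\Delta_n]_{i_n}$, with formulas and boxed sequents listed according to these orders, is $\bot$ if $m=n=0$ and otherwise $A_1\vee\dots\vee A_m\vee\Box_{i_1}\underline{\Delta_1}_{\mathsf F}\vee\dots\vee\Box_{i_n}\underline{\Delta_n}_{\mathsf F}$. **Theorem (Deep into shallow).** For every ordinal $\alpha$ and every nested sequent $\Gamma$: if $\Gamma$ has a cut-free proof in $D_C$ of depth at most $\alpha$, then the shallow sequent consisting of the single formula $\underline{\Gamma}_{\mathsf F}$ has a cut-free proof in $G_C$ of depth at most $\omega\cdot(\alpha+1)$. -/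

import Mathlib

open Ordinal

universe u v

namespace CommonKnowledge

/-! ## Formulas -/

/-- Formulas of the logic of common knowledge with agents `Fin h` and propositions `P`, in negation
normal form. `cbox` is the common knowledge operator and `cdia` its De Morgan dual. -/
inductive Formula (h : ℕ) (P : Type u) : Type u
  | pos (p : P) : Formula h P
  | neg (p : P) : Formula h P
  | or (A B : Formula h P) : Formula h P
  | and (A B : Formula h P) : Formula h P
  | dia (i : Fin h) (A : Formula h P) : Formula h P
  | box (i : Fin h) (A : Formula h P) : Formula h P
  | cdia (A : Formula h P) : Formula h P
  | cbox (A : Formula h P) : Formula h P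

namespace Formula

variable {h : ℕ} {P : Type u}

/-- Falsum, built from a chosen proposition `p`: the formula `p ∧ ¬p`. -/
def bot (p : P) : Formula h P := and (pos p) (neg p)

/-- The left-associated disjunction of a list of formulas; falsum if the list is empty. -/
def disj (p : P) : List (Formula h P) → Formula h P
  | [] => bot p
  | A :: L => L.foldl or A

/-- "Everybody knows `A`": the left-associated conjunction of `box i A` over all agents `i`. -/
def everyBox [NeZero h] (A : Formula h P) : Formula h P :=
  ((List.finRange h).tail.map fun i => box i A).foldl and (box 0 A)

/-- The dual of `everyBox`: the left-associated disjunction of `dia i A` over all agents `i`. -/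
def everyDia [NeZero h] (A : Formula h P) : Formula h P :=
  ((List.finRange h).tail.map fun i => dia i A).foldl or (dia 0 A)

end Formula

/-! ## The shallow system -/

/-- Proofs in the shallow sequent system (without cut). A shallow sequent is a finite multiset of
formulas. The rule `cbox` has one premise for every `k + 1 ≥ 1`. -/
inductive ShallowProof {h : ℕ} [NeZero h] {P : Type u} : Multiset (Formula h P) → Type u
  | ax (Γ : Multiset (Formula h P)) (p : P) : ShallowProof (Γ + {.pos p} + {.neg p})
  | and (Γ : Multiset (Formula h P)) (A B : Formula h P) :
      ShallowProof (Γ + {A}) → ShallowProof (Γ + {B}) → ShallowProof (Γ + {.and A B})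
  | or (Γ : Multiset (Formula h P)) (A B : Formula h P) :
      ShallowProof (Γ + {A} + {B}) → ShallowProof (Γ + {.or A B})
  | box (i : Fin h) (Γ Δ : Multiset (Formula h P)) (A : Formula h P)
      (S : Multiset (Formula h P)) :
      ShallowProof (Γ + Δ.map .cdia + {A}) →
      ShallowProof (Γ.map (.dia i) + Δ.map .cdia + {.box i A} + S)
  | cbox (Γ : Multiset (Formula h P)) (A : Formula h P) :
      (∀ k : ℕ, ShallowProof (Γ + {Formula.everyBox^[k + 1] A})) →
      ShallowProof (Γ + {.cbox A})
  | cdia (Γ : Multiset (Formula h P)) (A : Formula h P) :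
      ShallowProof (Γ + {.cdia A} + {Formula.everyDia A}) → ShallowProof (Γ + {.cdia A})

/-- The depth of a proof tree: axioms have depth `0`, and any other proof has as depth the supremum
of the successors of the depths of its immediate subproofs. -/
noncomputable def ShallowProof.depth {h : ℕ} [NeZero h] {P : Type u} :
    {Γ : Multiset (Formula h P)} → ShallowProof Γ → Ordinal.{v}
  | _, .ax _ _ => 0
  | _, .and _ _ _ π₁ π₂ => max (Order.succ π₁.depth) (Order.succ π₂.depth)
  | _, .or _ _ _ π => Order.succ π.depth
  | _, .box _ _ _ _ _ π => Order.succ π.depth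
  | _, .cbox _ _ π => ⨆ k : ℕ, Order.succ (π k).depth
  | _, .cdia _ _ π => Order.succ π.depth

/-- `ShallowProvable α Γ`: there is a cut-free shallow proof of `Γ` of depth at most `α`. -/
def ShallowProvable {h : ℕ} [NeZero h] {P : Type u} (α : Ordinal.{v})
    (Γ : Multiset (Formula h P)) : Prop :=
  ∃ π : ShallowProof Γ, π.depth ≤ α

/-! ## Nested sequents -/

/-- Finite lists whose entries are formulas and boxed lists `[Δ]_i` of the same kind. -/
inductive PreSequent (h : ℕ) (P : Type u) : Type u
  | nil : PreSequent h P
  | formula (A : Formula h P) (Γ : PreSequent h P) : PreSequent h P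
  | boxed (i : Fin h) (Δ Γ : PreSequent h P) : PreSequent h P

/-- Equality up to the order of the entries, at all levels of nesting. -/
inductive PreSequent.Equiv {h : ℕ} {P : Type u} : PreSequent h P → PreSequent h P → Prop
  | refl (Γ : PreSequent h P) : Equiv Γ Γ
  | symm {Γ Γ' : PreSequent h P} : Equiv Γ Γ' → Equiv Γ' Γ
  | trans {Γ Γ' Γ'' : PreSequent h P} : Equiv Γ Γ' → Equiv Γ' Γ'' → Equiv Γ Γ''
  | formula_congr (A : Formula h P) {Γ Γ' : PreSequent h P} :
      Equiv Γ Γ' → Equiv (.formula A Γ) (.formula A Γ')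
  | boxed_congr (i : Fin h) {Δ Δ' Γ Γ' : PreSequent h P} :
      Equiv Δ Δ' → Equiv Γ Γ' → Equiv (.boxed i Δ Γ) (.boxed i Δ' Γ')
  | swap_formula_formula (A B : Formula h P) (Γ : PreSequent h P) :
      Equiv (.formula A (.formula B Γ)) (.formula B (.formula A Γ))
  | swap_formula_boxed (A : Formula h P) (i : Fin h) (Δ Γ : PreSequent h P) :
      Equiv (.formula A (.boxed i Δ Γ)) (.boxed i Δ (.formula A Γ))
  | swap_boxed_boxed (i j : Fin h) (Δ Δ' Γ : PreSequent h P) :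
      Equiv (.boxed i Δ (.boxed j Δ' Γ)) (.boxed j Δ' (.boxed i Δ Γ))

instance PreSequent.setoid (h : ℕ) (P : Type u) : Setoid (PreSequent h P) :=
  ⟨PreSequent.Equiv, .refl, .symm, .trans⟩

/-- Nested sequents: finite multisets of formulas and boxed nested sequents. -/
def NestedSequent (h : ℕ) (P : Type u) : Type u := Quotient (PreSequent.setoid h P)

/-- A boxed sequent `[Δ]_i`. -/
structure BoxedSequent (h : ℕ) (P : Type u) : Type u where
  agent : Fin h
  content : NestedSequent h P

namespace PreSequent

variable {h : ℕ} {P : Type u}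

/-- Concatenation. -/
def append : PreSequent h P → PreSequent h P → PreSequent h P
  | .nil, X => X
  | .formula A Γ, X => .formula A (append Γ X)
  | .boxed i Δ Γ, X => .boxed i Δ (append Γ X)

/-- The number of constructors. -/
def size : PreSequent h P → ℕ
  | .nil => 1
  | .formula _ Γ => Γ.size + 1
  | .boxed _ Δ Γ => Δ.size + Γ.size + 1

/-- The formulas at the root. -/
def formulas : PreSequent h P → Multiset (Formula h P)
  | .nil => 0
  | .formula A Γ => A ::ₘ Γ.formulas
  | .boxed _ _ Γ => Γ.formulas

/-- The boxed sequents at the root. -/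
def boxes : PreSequent h P → Multiset (BoxedSequent h P)
  | .nil => 0
  | .formula _ Γ => Γ.boxes
  | .boxed i Δ Γ => ⟨i, Quotient.mk _ Δ⟩ ::ₘ Γ.boxes

theorem append_congr_left {Γ Γ' : PreSequent h P} (e : Γ.Equiv Γ') (X : PreSequent h P) :
    (Γ.append X).Equiv (Γ'.append X) := by
  induction e with
  | refl => exact .refl _
  | symm _ ih => exact ih.symm
  | trans _ _ ih₁ ih₂ => exact ih₁.trans ih₂
  | formula_congr A _ ih => exact ih.formula_congr A
  | boxed_congr i e₁ _ _ ih => exact .boxed_congr i e₁ ih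
  | swap_formula_formula => exact .swap_formula_formula _ _ _
  | swap_formula_boxed => exact .swap_formula_boxed _ _ _ _
  | swap_boxed_boxed => exact .swap_boxed_boxed _ _ _ _ _

theorem append_congr_right (Γ : PreSequent h P) {X X' : PreSequent h P} (e : X.Equiv X') :
    (Γ.append X).Equiv (Γ.append X') := by
  induction Γ with
  | nil => exact e
  | formula A _ ih => exact ih.formula_congr A
  | boxed i Δ _ _ ih => exact .boxed_congr i (.refl Δ) ih

theorem size_congr {Γ Γ' : PreSequent h P} (e : Γ.Equiv Γ') : Γ.size = Γ'.size := by
  induction e <;> (try simp only [size]) <;> omega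

theorem formulas_congr {Γ Γ' : PreSequent h P} (e : Γ.Equiv Γ') : Γ.formulas = Γ'.formulas := by
  induction e with
  | refl => rfl
  | symm _ ih => exact ih.symm
  | trans _ _ ih₁ ih₂ => exact ih₁.trans ih₂
  | formula_congr A _ ih => simp only [formulas, ih]
  | boxed_congr i _ _ _ ih => simp only [formulas, ih]
  | swap_formula_formula => exact Multiset.cons_swap _ _ _
  | swap_formula_boxed => rfl
  | swap_boxed_boxed => rfl

theorem boxes_congr {Γ Γ' : PreSequent h P} (e : Γ.Equiv Γ') : Γ.boxes = Γ'.boxes := by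
  induction e with
  | refl => rfl
  | symm _ ih => exact ih.symm
  | trans _ _ ih₁ ih₂ => exact ih₁.trans ih₂
  | formula_congr A _ ih => exact ih
  | boxed_congr i e₁ _ _ ih => simp only [boxes, ih, Quotient.sound (s := PreSequent.setoid h P) e₁]
  | swap_formula_formula => rfl
  | swap_formula_boxed => rfl
  | swap_boxed_boxed => exact Multiset.cons_swap _ _ _

end PreSequent

namespace NestedSequent

variable {h : ℕ} {P : Type u}

/-- The empty sequent. -/
def empty : NestedSequent h P := Quotient.mk _ .nil

/-- The sequent consisting of a single formula. -/
def ofFormula (A : Formula h P) : NestedSequent h P := Quotient.mk _ (.formula A .nil)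

/-- The sequent consisting of the single boxed sequent `[Δ]_i`. -/
def box (i : Fin h) (Δ : NestedSequent h P) : NestedSequent h P :=
  Quotient.map (fun Δ => .boxed i Δ .nil) (fun _ _ e => .boxed_congr i e (.refl _)) Δ

/-- Multiset union of sequents, written with a comma on paper. -/
instance : Add (NestedSequent h P) :=
  ⟨Quotient.map₂ PreSequent.append fun _ Γ' e X _ e' =>
    (PreSequent.append_congr_left e X).trans (PreSequent.append_congr_right Γ' e')⟩

/-- The formulas at the root. -/
def formulas (Γ : NestedSequent h P) : Multiset (Formula h P) :=
  Quotient.lift PreSequent.formulas (fun _ _ => PreSequent.formulas_congr) Γ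

/-- The boxed sequents at the root. -/
def boxes (Γ : NestedSequent h P) : Multiset (BoxedSequent h P) :=
  Quotient.lift PreSequent.boxes (fun _ _ => PreSequent.boxes_congr) Γ

/-- A size measure, used only for recursion. -/
def size (Γ : NestedSequent h P) : ℕ :=
  Quotient.lift PreSequent.size (fun _ _ => PreSequent.size_congr) Γ

theorem size_lt_of_mem_boxes {Γ : NestedSequent h P} {b : BoxedSequent h P}
    (hb : b ∈ Γ.boxes) : b.content.size < Γ.size := by
  induction Γ using Quotient.inductionOn with
  | h Γ =>
    change b ∈ Γ.boxes at hb
    change b.content.size < Γ.size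
    induction Γ with
    | nil => simp [PreSequent.boxes] at hb
    | formula A Γ ih =>
      have := ih hb
      simp only [PreSequent.size]
      omega
    | boxed i Δ Γ _ ih =>
      simp only [PreSequent.boxes, Multiset.mem_cons] at hb
      simp only [PreSequent.size]
      rcases hb with rfl | hb
      · change Δ.size < _
        omega
      · have := ih hb
        omega

/-- The corresponding formula of a nested sequent: the disjunction of its formulas and of the
formulas `box i A`, where `A` corresponds to `Δ`, for its boxed sequents `[Δ]_i`, both listed
according to the given linear orders. The empty sequent corresponds to falsum. -/
def toFormula [LinearOrder (Formula h P)] [LinearOrder (BoxedSequent h P)] (p : P)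
    (Γ : NestedSequent h P) : Formula h P :=
  Formula.disj p
    (Γ.formulas.sort (· ≤ ·) ++
      (Γ.boxes.sort (· ≤ ·)).attach.map fun b => .box b.1.agent (toFormula p b.1.content))
termination_by Γ.size
decreasing_by
  exact size_lt_of_mem_boxes (Multiset.mem_sort (r := (· ≤ ·)) |>.1 b.2)

/-- The defining equation of the corresponding formula. -/
theorem toFormula_eq [LinearOrder (Formula h P)] [LinearOrder (BoxedSequent h P)] (p : P)
    (Γ : NestedSequent h P) :
    Γ.toFormula p = Formula.disj p (Γ.formulas.sort (· ≤ ·) ++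
      (Γ.boxes.sort (· ≤ ·)).map fun b => .box b.agent (b.content.toFormula p)) := by
  rw [toFormula]
  congr 2
  exact List.attach_map_val (f := fun b : BoxedSequent h P =>
    Formula.box b.agent (b.content.toFormula p))

end NestedSequent

/-! ## The nested system -/

/-- Sequent contexts: sequents with exactly one hole, not inside a formula. -/
inductive Context (h : ℕ) (P : Type u) : Type u
  | hole (Δ : NestedSequent h P) : Context h P
  | boxed (Δ : NestedSequent h P) (i : Fin h) (C : Context h P) : Context h P

/-- Filling the hole of a context with a sequent. -/
def Context.fill {h : ℕ} {P : Type u} : Context h P → NestedSequent h P → NestedSequent h P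
  | .hole Δ, X => Δ + X
  | .boxed Δ i C, X => Δ + .box i (C.fill X)

open NestedSequent in
/-- Proofs in the nested sequent system (without cut). The rule `cbox` has one premise for every
`k + 1 ≥ 1`; the rule `cdia` has one instance for every `k + 1 ≥ 1`. -/
inductive DeepProof {h : ℕ} [NeZero h] {P : Type u} : NestedSequent h P → Type u
  | ax (C : Context h P) (p : P) : DeepProof (C.fill (ofFormula (.pos p) + ofFormula (.neg p)))
  | and (C : Context h P) (A B : Formula h P) :
      DeepProof (C.fill (ofFormula A)) → DeepProof (C.fill (ofFormula B)) →
      DeepProof (C.fill (ofFormula (.and A B)))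
  | or (C : Context h P) (A B : Formula h P) :
      DeepProof (C.fill (ofFormula A + ofFormula B)) →
      DeepProof (C.fill (ofFormula (.or A B)))
  | box (C : Context h P) (i : Fin h) (A : Formula h P) :
      DeepProof (C.fill (box i (ofFormula A))) →
      DeepProof (C.fill (ofFormula (.box i A)))
  | dia (C : Context h P) (i : Fin h) (A : Formula h P) (Δ : NestedSequent h P) :
      DeepProof (C.fill (ofFormula (.dia i A) + box i (Δ + ofFormula A))) →
      DeepProof (C.fill (ofFormula (.dia i A) + box i Δ))
  | cbox (C : Context h P) (A : Formula h P) :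
      (∀ k : ℕ, DeepProof (C.fill (ofFormula (Formula.everyBox^[k + 1] A)))) →
      DeepProof (C.fill (ofFormula (.cbox A)))
  | cdia (C : Context h P) (A : Formula h P) (k : ℕ) :
      DeepProof (C.fill (ofFormula (.cdia A) + ofFormula (Formula.everyDia^[k + 1] A))) →
      DeepProof (C.fill (ofFormula (.cdia A)))

/-- The depth of a proof tree in the nested system, as for shallow proofs. -/
noncomputable def DeepProof.depth {h : ℕ} [NeZero h] {P : Type u} :
    {Γ : NestedSequent h P} → DeepProof Γ → Ordinal.{v}
  | _, .ax _ _ => 0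
  | _, .and _ _ _ π₁ π₂ => max (Order.succ π₁.depth) (Order.succ π₂.depth)
  | _, .or _ _ _ π => Order.succ π.depth
  | _, .box _ _ _ π => Order.succ π.depth
  | _, .dia _ _ _ _ π => Order.succ π.depth
  | _, .cbox _ _ π => ⨆ k : ℕ, Order.succ (π k).depth
  | _, .cdia _ _ _ π => Order.succ π.depth

/-- `DeepProvable α Γ`: there is a cut-free nested proof of `Γ` of depth at most `α`. -/
def DeepProvable {h : ℕ} [NeZero h] {P : Type u} (α : Ordinal.{v})
    (Γ : NestedSequent h P) : Prop :=
  ∃ π : DeepProof Γ, π.depth ≤ α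

end CommonKnowledge

namespace CommonKnowledge

variable {h : ℕ} {P : Type u}

/-! ## A shallow calculus on sets of formulas -/

/-! Each deep rule is simulated in the shallow system at the price of finitely many extra levels,
the number depending on the rule instance but not on the depth of the premises. A deep proof of
depth δ thus yields a shallow one of depth `ω * δ + n` for some finite n. The finite surpluses of
the premises, even infinitely many unbounded ones, are absorbed because ω·γ + m ≤ ω·δ whenever γ <
δ. Forming the final disjunction again costs finitely many levels, so ω·(α+1) suffices.

The difficulty is a rule applied under boxes, since a shallow proof of □_i A, X need not end with
the box rule for □_i A (`SetProvable.box_family`). Working upwards from the conclusion, X is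
decomposed by the local rules until it is saturated. A proof of a saturated sequent is an axiom or
comes from a box rule: either □_i A is not involved and can be dropped, or the premise of the box
rule for □_i A is provable and the rule can be applied there. The decomposition may branch
infinitely at □*, but only formulas from a fixed finite set survive the box rule, so finitely many
costs occur and they have a maximum.

The other obstacle is the deep rule for ◇* with arbitrary k, against shallow unfolding by one step
only: the missing steps are regained one at a time, each time a box rule is crossed
(`SetProvable.of_range_dia`).

The bookkeeping is done in a calculus on sets, where weakening and contraction are built in;
depth-preserving inversion leads back to multisets. -/

/-- What remains of the side formulas `N` in the premise of a box rule for agent `i`. -/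
def boxStep (i : Fin h) (N : Set (Formula h P)) : Set (Formula h P) :=
  {B | .dia i B ∈ N} ∪ {C | C ∈ N ∧ ∃ B, C = .cdia B}

theorem boxStep_mono (i : Fin h) {N N' : Set (Formula h P)} (hN : N ⊆ N') :
    boxStep i N ⊆ boxStep i N' := by
  rintro B (hB | ⟨hB, e⟩)
  · exact Or.inl (hN hB)
  · exact Or.inr ⟨hN hB, e⟩

/-- Brings the side formulas into the shape that the shallow box rule demands, with everything the
rule forgets collected in `S`. -/
theorem exists_boxStep_decomposition (i : Fin h) (M : Multiset (Formula h P)) :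
    ∃ Γ Δ S : Multiset (Formula h P), M = Γ.map (.dia i) + Δ.map .cdia + S ∧
      ∀ C ∈ boxStep i {F | F ∈ M}, C ∈ Γ + Δ.map .cdia := by
  induction M using Multiset.induction with
  | empty => exact ⟨0, 0, 0, rfl, by simp [boxStep]⟩
  | cons F M ih =>
    obtain ⟨Γ, Δ, S, rfl, hC⟩ := ih
    by_cases h₁ : ∃ B, F = .dia i B
    · obtain ⟨B, rfl⟩ := h₁
      refine ⟨B ::ₘ Γ, Δ, S, by simp, fun C hC' => ?_⟩
      have := hC C
      simp only [boxStep, Set.mem_union, Set.mem_ofPred_eq, Multiset.mem_cons,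
        Multiset.mem_add] at *
      grind
    by_cases h₂ : ∃ B, F = .cdia B
    · obtain ⟨B, rfl⟩ := h₂
      refine ⟨Γ, B ::ₘ Δ, S, by simp, fun C hC' => ?_⟩
      have := hC C
      simp only [boxStep, Set.mem_union, Set.mem_ofPred_eq, Multiset.mem_cons, Multiset.mem_add,
        Multiset.map_cons] at *
      grind
    · refine ⟨Γ, Δ, F ::ₘ S, by simp, fun C hC' => ?_⟩
      have := hC C
      simp only [boxStep, Set.mem_union, Set.mem_ofPred_eq, Multiset.mem_cons,
        Multiset.mem_add] at *
      grind

variable [NeZero h]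

/-- Shallow provability, with an upper bound on the depth, for sets of formulas. Premises keep the
principal formula, except for the box rule. -/
inductive SetProvable : Ordinal.{v} → Set (Formula h P) → Prop
  | ax {β : Ordinal} {N : Set (Formula h P)} {p : P} :
      .pos p ∈ N → .neg p ∈ N → SetProvable β N
  | and {β β' : Ordinal} {N : Set (Formula h P)} {A B : Formula h P} :
      .and A B ∈ N → β' < β → SetProvable β' (insert A N) → SetProvable β' (insert B N) →
      SetProvable β N
  | or {β β' : Ordinal} {N : Set (Formula h P)} {A B : Formula h P} :
      .or A B ∈ N → β' < β → SetProvable β' (insert A (insert B N)) → SetProvable β N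
  | box {β β' : Ordinal} {N : Set (Formula h P)} {i : Fin h} {A : Formula h P} :
      .box i A ∈ N → β' < β → SetProvable β' (insert A (boxStep i N)) → SetProvable β N
  | cbox {β : Ordinal} {N : Set (Formula h P)} {A : Formula h P} (β' : ℕ → Ordinal) :
      .cbox A ∈ N → (∀ k, β' k < β) →
      (∀ k, SetProvable (β' k) (insert (Formula.everyBox^[k + 1] A) N)) → SetProvable β N
  | cdia {β β' : Ordinal} {N : Set (Formula h P)} {A : Formula h P} :
      .cdia A ∈ N → β' < β → SetProvable β' (insert (Formula.everyDia A) N) → SetProvable β N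

theorem SetProvable.weaken {β : Ordinal.{v}} {N N' : Set (Formula h P)} (π : SetProvable β N)
    (hN : N ⊆ N') : SetProvable β N' := by
  induction π generalizing N' with
  | ax h₁ h₂ => exact .ax (hN h₁) (hN h₂)
  | and h₁ hβ _ _ ih₁ ih₂ =>
    exact .and (hN h₁) hβ (ih₁ (Set.insert_subset_insert hN)) (ih₂ (Set.insert_subset_insert hN))
  | or h₁ hβ _ ih =>
    exact .or (hN h₁) hβ (ih (Set.insert_subset_insert (Set.insert_subset_insert hN)))
  | box h₁ hβ _ ih => exact .box (hN h₁) hβ (ih (Set.insert_subset_insert (boxStep_mono _ hN)))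
  | cbox β' h₁ hβ _ ih => exact .cbox β' (hN h₁) hβ fun k => ih k (Set.insert_subset_insert hN)
  | cdia h₁ hβ _ ih => exact .cdia (hN h₁) hβ (ih (Set.insert_subset_insert hN))

theorem SetProvable.mono {β γ : Ordinal.{v}} {N : Set (Formula h P)} (π : SetProvable β N)
    (hβ : β ≤ γ) : SetProvable γ N := by
  cases π with
  | ax h₁ h₂ => exact .ax h₁ h₂
  | and h₁ h₂ π₁ π₂ => exact .and h₁ (h₂.trans_le hβ) π₁ π₂
  | or h₁ h₂ π => exact .or h₁ (h₂.trans_le hβ) π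
  | box h₁ h₂ π => exact .box h₁ (h₂.trans_le hβ) π
  | cbox β' h₁ h₂ π => exact .cbox β' h₁ (fun k => (h₂ k).trans_le hβ) π
  | cdia h₁ h₂ π => exact .cdia h₁ (h₂.trans_le hβ) π

/-- `R` contains the side formulas of a premise of an invertible rule with principal formula `F`. -/
def Inverts (R : Set (Formula h P)) : Formula h P → Prop
  | .and A B => A ∈ R ∨ B ∈ R
  | .or A B => A ∈ R ∧ B ∈ R
  | .cbox A => ∃ k : ℕ, Formula.everyBox^[k + 1] A ∈ R
  | _ => False

/-- Depth-preserving inversion. Where `F` is principal, a suitable premise already has its side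
formulas in `R`, so the rule is skipped. The box rule does not notice `F`, which is neither a
diamond nor a ◇*-formula. -/
theorem SetProvable.invert {β : Ordinal.{v}} {N N' R : Set (Formula h P)} {F : Formula h P}
    (π : SetProvable β N) (hF : Inverts R F) (hN : N ⊆ insert F N') :
    SetProvable β (R ∪ N') := by
  induction π generalizing N' with
  | @ax β N p h₁ h₂ =>
    have h₁ := hN h₁
    have h₂ := hN h₂
    rcases h₁ with rfl | h₁
    · exact hF.elim
    rcases h₂ with rfl | h₂
    · exact hF.elim
    exact .ax (Or.inr h₁) (Or.inr h₂)
  | @and β β' N A B h₁ hβ _ _ ih₁ ih₂ =>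
    have j₁ := ih₁ (N' := insert A N') (by grind)
    have j₂ := ih₂ (N' := insert B N') (by grind)
    rcases hN h₁ with rfl | h₁
    · rcases hF with hF | hF
      · exact (j₁.weaken (by grind)).mono hβ.le
      · exact (j₂.weaken (by grind)).mono hβ.le
    · exact .and (Or.inr h₁) hβ (j₁.weaken (by grind)) (j₂.weaken (by grind))
  | @or β β' N A B h₁ hβ _ ih =>
    have j := ih (N' := insert A (insert B N')) (by grind)
    rcases hN h₁ with rfl | h₁
    · exact (j.weaken (by have := hF.1; have := hF.2; grind)).mono hβ.le
    · exact .or (Or.inr h₁) hβ (j.weaken (by grind))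
  | @box β β' N i A h₁ hβ π ih =>
    rcases hN h₁ with rfl | h₁
    · exact hF.elim
    · refine .box (Or.inr h₁) hβ (π.weaken (Set.insert_subset_insert ?_))
      rintro C (hC | ⟨hC, B, rfl⟩)
      · rcases hN hC with rfl | hC
        · exact hF.elim
        · exact Or.inl (Or.inr hC)
      · rcases hN hC with rfl | hC
        · exact hF.elim
        · exact Or.inr ⟨Or.inr hC, _, rfl⟩
  | @cbox β N A β' h₁ hβ _ ih =>
    have j := fun k => ih k (N' := insert (Formula.everyBox^[k + 1] A) N') (by grind)
    rcases hN h₁ with rfl | h₁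
    · obtain ⟨k, hk⟩ := hF
      exact ((j k).weaken (by grind)).mono (hβ k).le
    · exact .cbox β' (Or.inr h₁) hβ fun k => (j k).weaken (by grind)
  | @cdia β β' N A h₁ hβ _ ih =>
    have j := ih (N' := insert (Formula.everyDia A) N') (by grind)
    rcases hN h₁ with rfl | h₁
    · exact hF.elim
    · exact .cdia (Or.inr h₁) hβ (j.weaken (by grind))

/-- The shallow rules for ∧, ∨ and □* consume their principal formula while the set calculus keeps
it; inversion removes it from the premises without raising the depth. -/
theorem SetProvable.shallowProvable {β : Ordinal.{v}} {N : Set (Formula h P)}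
    (π : SetProvable β N) {M : Multiset (Formula h P)} (hN : ∀ F ∈ N, F ∈ M) :
    ShallowProvable β M := by
  -- An inverted premise is not a subderivation, so the induction runs on the depth bound.
  induction β using WellFoundedLT.induction generalizing N M with
  | ind β ih =>
    cases π with
    | @ax _ _ p h₁ h₂ =>
      obtain ⟨M₁, rfl⟩ := Multiset.exists_cons_of_mem (hN _ h₁)
      have h₂ := hN _ h₂
      simp only [Multiset.mem_cons, reduceCtorEq, false_or] at h₂
      obtain ⟨M₂, rfl⟩ := Multiset.exists_cons_of_mem h₂
      have e : Formula.pos p ::ₘ Formula.neg p ::ₘ M₂ = M₂ + {.pos p} + {.neg p} := by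
        rw [Multiset.cons_swap, ← Multiset.singleton_add, ← Multiset.singleton_add,
          add_comm, add_comm _ M₂]
      rw [e]
      exact ⟨.ax M₂ p, by simp [ShallowProof.depth]⟩
    | @and _ β' _ A B h₁ hβ π₁ π₂ =>
      obtain ⟨M, rfl⟩ := Multiset.exists_cons_of_mem (hN _ h₁)
      obtain ⟨ρ₁, d₁⟩ := ih β' hβ (π₁.invert (R := {A}) (N' := insert A {F | F ∈ M})
        (F := .and A B) (Or.inl rfl) (by intro F hF; have := hN F; simp at *; grind))
        (M := M + {A}) (by simp; grind)
      obtain ⟨ρ₂, d₂⟩ := ih β' hβ (π₂.invert (R := {B}) (N' := insert B {F | F ∈ M})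
        (F := .and A B) (Or.inr rfl) (by intro F hF; have := hN F; simp at *; grind))
        (M := M + {B}) (by simp; grind)
      rw [← Multiset.singleton_add, add_comm]
      exact ⟨.and M A B ρ₁ ρ₂, max_le (Order.succ_le_of_lt (d₁.trans_lt hβ))
        (Order.succ_le_of_lt (d₂.trans_lt hβ))⟩
    | @or _ β' _ A B h₁ hβ π =>
      obtain ⟨M, rfl⟩ := Multiset.exists_cons_of_mem (hN _ h₁)
      obtain ⟨ρ, d⟩ := ih β' hβ (π.invert (R := {A, B}) (N' := insert A (insert B {F | F ∈ M}))
        (F := .or A B) (by simp [Inverts]) (by intro F hF; have := hN F; simp at *; grind))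
        (M := M + {A} + {B}) (by simp; grind)
      rw [← Multiset.singleton_add, add_comm]
      exact ⟨.or M A B ρ, Order.succ_le_of_lt (d.trans_lt hβ)⟩
    | @box _ β' _ i A h₁ hβ π =>
      obtain ⟨M, rfl⟩ := Multiset.exists_cons_of_mem (hN _ h₁)
      obtain ⟨Γ, Δ, S, rfl, hC⟩ := exists_boxStep_decomposition i M
      obtain ⟨ρ, d⟩ := ih β' hβ π (M := Γ + Δ.map .cdia + {A}) (by
        rintro F (rfl | hF)
        · simp
        · refine Multiset.mem_add.2 (Or.inl (hC F ?_))
          rcases hF with hF | ⟨hF, B, rfl⟩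
          · exact Or.inl ((Multiset.mem_cons.1 (hN _ hF)).resolve_left (by simp))
          · exact Or.inr ⟨(Multiset.mem_cons.1 (hN _ hF)).resolve_left (by simp), _, rfl⟩)
      have e : Formula.box i A ::ₘ (Γ.map (.dia i) + Δ.map .cdia + S) =
          Γ.map (.dia i) + Δ.map .cdia + {.box i A} + S := by
        rw [← Multiset.singleton_add]; abel
      rw [e]
      exact ⟨.box i Γ Δ A S ρ, Order.succ_le_of_lt (d.trans_lt hβ)⟩
    | @cbox _ _ A β' h₁ hβ π =>
      obtain ⟨M, rfl⟩ := Multiset.exists_cons_of_mem (hN _ h₁)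
      have key := fun k => ih (β' k) (hβ k) ((π k).invert (R := {Formula.everyBox^[k + 1] A})
        (N' := insert (Formula.everyBox^[k + 1] A) {F | F ∈ M})
        (F := .cbox A) ⟨k, rfl⟩ (by intro F hF; have := hN F; simp at *; grind))
        (M := M + {Formula.everyBox^[k + 1] A}) (by simp; grind)
      choose ρ d using key
      rw [← Multiset.singleton_add, add_comm]
      exact ⟨.cbox M A ρ, Ordinal.iSup_le fun k => Order.succ_le_of_lt ((d k).trans_lt (hβ k))⟩
    | @cdia _ β' _ A h₁ hβ π =>
      obtain ⟨M, rfl⟩ := Multiset.exists_cons_of_mem (hN _ h₁)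
      obtain ⟨ρ, d⟩ := ih β' hβ π (M := M + {.cdia A} + {Formula.everyDia A})
        (by intro F hF; have := hN F; simp at *; grind)
      rw [← Multiset.singleton_add, add_comm]
      exact ⟨.cdia M A ρ, Order.succ_le_of_lt (d.trans_lt hβ)⟩

end CommonKnowledge

namespace CommonKnowledge

variable {h : ℕ} {P : Type u}

/-! ## Iterated disjunctions and conjunctions -/

theorem lt_add_natCast_succ (β : Ordinal.{v}) (n : ℕ) :
    β + (n : Ordinal) < β + ((n + 1 : ℕ) : Ordinal) := by
  gcongr
  omega

/-- Finite ordinals satisfy 1 + n = n + 1, so adding n on the right preserves strict inequalities;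
this fails for infinite summands. -/
theorem add_natCast_le {β' β : Ordinal.{v}} (hβ : β' < β) (n : ℕ) :
    β' + ((n + 1 : ℕ) : Ordinal) ≤ β + (n : Ordinal) := by
  have : ((n + 1 : ℕ) : Ordinal.{v}) = 1 + (n : Ordinal) := by
    rw [add_comm n 1]; push_cast; rfl
  rw [this, ← add_assoc]
  gcongr
  exact Order.add_one_le_of_lt hβ

/-- Splitting a disjunction is free, by inversion; only assembling one costs a level per connective.
-/
theorem SetProvable.of_foldl_or [NeZero h] {β : Ordinal.{v}} (L : List (Formula h P))
    {A : Formula h P}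
    {N : Set (Formula h P)} (π : SetProvable β (insert (L.foldl .or A) N)) :
    SetProvable β (insert A ({F | F ∈ L} ∪ N)) := by
  induction L generalizing A with
  | nil => exact π.weaken (by simp)
  | cons B L ih =>
    refine ((ih π).invert (R := {A, B}) (F := .or A B) (N' := {F | F ∈ L} ∪ N)
      (by simp [Inverts]) subset_rfl).weaken ?_
    intro F hF
    simp at *
    grind

theorem SetProvable.foldl_or [NeZero h] {β : Ordinal.{v}} (L : List (Formula h P)) {A : Formula h P}
    {N : Set (Formula h P)} (π : SetProvable β (insert A ({F | F ∈ L} ∪ N))) :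
    SetProvable (β + (L.length : Ordinal)) (insert (L.foldl .or A) N) := by
  induction L generalizing A β with
  | nil => simpa using π
  | cons B L ih =>
    have : SetProvable (β + 1) (insert (A.or B) ({F | F ∈ L} ∪ N)) := by
      refine .or (A := A) (B := B) (Or.inl rfl) (lt_add_one β) (π.weaken ?_)
      intro F hF
      simp at *
      grind
    refine (ih this).mono ?_
    rw [add_assoc, List.length_cons, add_comm L.length 1]
    push_cast
    rfl

theorem SetProvable.of_everyDia [NeZero h] {β : Ordinal.{v}} {A : Formula h P} {N : Set
    (Formula h P)}
    (π : SetProvable β (insert (Formula.everyDia A) N)) :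
    SetProvable β (Set.range (fun i => Formula.dia i A) ∪ N) := by
  refine (SetProvable.of_foldl_or _ π).weaken ?_
  rintro F (rfl | hF | hF)
  · exact Or.inl ⟨0, rfl⟩
  · obtain ⟨i, -, rfl⟩ := List.mem_map.1 hF
    exact Or.inl ⟨i, rfl⟩
  · exact Or.inr hF

theorem mem_map_finRange_tail [NeZero h] {i : Fin h} {α : Type*} {f : Fin h → α} :
    f i = f 0 ∨ f i ∈ (List.finRange h).tail.map f := by
  obtain ⟨n, rfl⟩ : ∃ n, h = n + 1 := ⟨h - 1, by have := NeZero.pos h; omega⟩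
  have : i ∈ List.finRange (n + 1) := List.mem_finRange i
  rw [List.finRange_succ] at this ⊢
  rcases List.mem_cons.1 this with rfl | hi
  · exact Or.inl rfl
  · exact Or.inr (List.mem_map_of_mem hi)

theorem SetProvable.everyDia [NeZero h] {β : Ordinal.{v}} {A : Formula h P} {N : Set (Formula h P)}
    (π : SetProvable β (Set.range (fun i => Formula.dia i A) ∪ N)) :
    SetProvable (β + (h : Ordinal)) (insert (Formula.everyDia A) N) := by
  refine (SetProvable.foldl_or ((List.finRange h).tail.map fun i => Formula.dia i A) (A := .dia 0 A)
    (π.weaken ?_)).mono ?_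
  · rintro F (⟨i, rfl⟩ | hF)
    · rcases mem_map_finRange_tail (i := i) (f := fun i => Formula.dia i A) with hi | hi
      · exact Or.inl hi
      · exact Or.inr (Or.inl hi)
    · exact Or.inr (Or.inr hF)
  · gcongr
    simp

theorem SetProvable.of_disj [NeZero h] {β : Ordinal.{v}} {p : P} {L : List (Formula h P)}
    (hL : L ≠ [])
    {N : Set (Formula h P)} (π : SetProvable β (insert (Formula.disj p L) N)) :
    SetProvable β ({F | F ∈ L} ∪ N) := by
  cases L with
  | nil => exact (hL rfl).elim
  | cons A L =>
    refine (SetProvable.of_foldl_or L π).weaken ?_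
    intro F hF
    simp at *
    grind

theorem SetProvable.disj [NeZero h] {β : Ordinal.{v}} (p : P) {L : List (Formula h P)}
    {N : Set (Formula h P)} (π : SetProvable β ({F | F ∈ L} ∪ N)) :
    SetProvable (β + (L.length : Ordinal)) (insert (Formula.disj p L) N) := by
  cases L with
  | nil => simpa using π.weaken (by simp)
  | cons A L =>
    refine (SetProvable.foldl_or L (A := A) (π.weaken ?_)).mono ?_
    · intro F hF
      simp at *
      grind
    · gcongr
      simp

/-! ## Local saturation -/

/-- The formulas that the local rules and a box rule may extract from a formula. -/
def future : Formula h P → Set (Formula h P)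
  | .or A B => future A ∪ future B
  | .and A B => future A ∪ future B
  | .dia _ A => {A}
  | .cdia A => {.cdia A, A}
  | _ => ∅

theorem finite_future (F : Formula h P) : (future F).Finite := by
  induction F with
  | or A B hA hB => exact hA.union hB
  | and A B hA hB => exact hA.union hB
  | _ => simp [future]

theorem future_foldl_or (L : List (Formula h P)) (A : Formula h P) {T : Set (Formula h P)}
    (hA : future A ⊆ T) (hL : ∀ B ∈ L, future B ⊆ T) : future (L.foldl .or A) ⊆ T := by
  induction L generalizing A with
  | nil => exact hA
  | cons B L ih =>
    exact ih (A.or B) (Set.union_subset hA (hL B (by simp))) fun C hC => hL C (by simp [hC])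

theorem future_foldl_and (L : List (Formula h P)) (A : Formula h P) {T : Set (Formula h P)}
    (hA : future A ⊆ T) (hL : ∀ B ∈ L, future B ⊆ T) : future (L.foldl .and A) ⊆ T := by
  induction L generalizing A with
  | nil => exact hA
  | cons B L ih =>
    exact ih (A.and B) (Set.union_subset hA (hL B (by simp))) fun C hC => hL C (by simp [hC])

theorem future_everyDia [NeZero h] (A : Formula h P) : future (Formula.everyDia A) ⊆ {A} :=
  future_foldl_or _ _ (by simp [future]) fun B hB => by
    obtain ⟨i, -, rfl⟩ := List.mem_map.1 hB
    simp [future]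

/-- Whatever k a branch of the □* rule chooses, it contributes nothing to the premise of a later box
rule. This is what keeps the relevant side formulas finite in number. -/
theorem future_everyBox [NeZero h] (A : Formula h P) : future (Formula.everyBox A) ⊆ ∅ :=
  future_foldl_and _ _ (by simp [future]) fun B hB => by
    obtain ⟨i, -, rfl⟩ := List.mem_map.1 hB
    simp [future]

/-- A bound on the number of local rules needed to decompose a formula. -/
def weight : Formula h P → ℕ
  | .or A B => weight A + weight B + 1
  | .and A B => weight A + weight B + 1
  | .cdia _ => 2 * h + 1
  | .cbox _ => 2 * h + 1
  | _ => 1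

theorem weight_pos (F : Formula h P) : 0 < weight F := by
  cases F <;> simp [weight]

theorem weight_everyDia [NeZero h] (A : Formula h P) : weight (Formula.everyDia A) < 2 * h + 1 := by
  have key : ∀ (L : List (Fin h)) (B : Formula h P),
      weight ((L.map fun i => Formula.dia i A).foldl .or B) = weight B + 2 * L.length := by
    intro L
    induction L with
    | nil => simp
    | cons i L ih =>
      intro B
      simp only [List.map_cons, List.foldl_cons, ih, weight, List.length_cons]
      omega
  have := NeZero.pos h
  simp only [Formula.everyDia, key, weight, List.length_tail, List.length_finRange]
  omega

theorem weight_everyBox [NeZero h] (A : Formula h P) : weight (Formula.everyBox A) < 2 * h + 1 := by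
  have key : ∀ (L : List (Fin h)) (B : Formula h P),
      weight ((L.map fun i => Formula.box i A).foldl .and B) = weight B + 2 * L.length := by
    intro L
    induction L with
    | nil => simp
    | cons i L ih =>
      intro B
      simp only [List.map_cons, List.foldl_cons, ih, weight, List.length_cons]
      omega
  have := NeZero.pos h
  simp only [Formula.everyBox, key, weight, List.length_tail, List.length_finRange]
  omega

/-- No rule other than the box rule, applied to `F`, adds anything to `N`. -/
def Saturated [NeZero h] (N : Set (Formula h P)) : Formula h P → Prop
  | .or A B => A ∈ N ∧ B ∈ N
  | .and A B => A ∈ N ∨ B ∈ N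
  | .cbox A => ∃ k : ℕ, Formula.everyBox^[k + 1] A ∈ N
  | .cdia A => Formula.everyDia A ∈ N
  | _ => True

theorem Saturated.mono [NeZero h] {N N' : Set (Formula h P)} (hN : N ⊆ N') {F : Formula h P}
    (hF : Saturated N F) : Saturated N' F := by
  cases F with
  | or A B => exact ⟨hN hF.1, hN hF.2⟩
  | and A B => exact hF.imp (@hN _) (@hN _)
  | cbox A => exact hF.imp fun _ hk => hN hk
  | cdia A => exact hN hF
  | _ => trivial

/-- A provable saturated sequent is an axiom or the conclusion of a box rule. -/
theorem SetProvable.cases_saturated [NeZero h] {β : Ordinal.{v}} {N : Set (Formula h P)}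
    (π : SetProvable β N) (hN : ∀ F ∈ N, Saturated N F) :
    (∃ p : P, .pos p ∈ N ∧ .neg p ∈ N) ∨
      ∃ i A, .box i A ∈ N ∧ ∃ β' < β, SetProvable β' (insert A (boxStep i N)) := by
  -- By saturation each non-box rule has a premise with the same set `N`; descending into it only
  -- lowers the bound.
  have step : ∀ {β' β : Ordinal.{v}} {N : Set (Formula h P)}, β' < β →
      ((∃ p : P, .pos p ∈ N ∧ .neg p ∈ N) ∨
        ∃ i A, .box i A ∈ N ∧ ∃ γ < β', SetProvable γ (insert A (boxStep i N))) →
      (∃ p : P, .pos p ∈ N ∧ .neg p ∈ N) ∨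
        ∃ i A, .box i A ∈ N ∧ ∃ γ < β, SetProvable γ (insert A (boxStep i N)) := by
    rintro β' β N hβ (H | ⟨i, A, hA, γ, hγ, π⟩)
    · exact Or.inl H
    · exact Or.inr ⟨i, A, hA, γ, hγ.trans hβ, π⟩
  induction π with
  | ax h₁ h₂ => exact Or.inl ⟨_, h₁, h₂⟩
  | and h₁ hβ π₁ π₂ ih₁ ih₂ =>
    rcases hN _ h₁ with hA | hB
    · rw [Set.insert_eq_of_mem hA] at ih₁
      exact step hβ (ih₁ hN)
    · rw [Set.insert_eq_of_mem hB] at ih₂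
      exact step hβ (ih₂ hN)
  | or h₁ hβ π ih =>
    obtain ⟨hA, hB⟩ := hN _ h₁
    rw [Set.insert_eq_of_mem hB, Set.insert_eq_of_mem hA] at ih
    exact step hβ (ih hN)
  | box h₁ hβ π => exact Or.inr ⟨_, _, h₁, _, hβ, π⟩
  | cbox β' h₁ hβ π ih =>
    obtain ⟨k, hk⟩ := hN _ h₁
    have := ih k
    rw [Set.insert_eq_of_mem hk] at this
    exact step (hβ k) (this hN)
  | cdia h₁ hβ π ih =>
    have hA : _ ∈ _ := hN _ h₁
    rw [Set.insert_eq_of_mem hA] at ih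
    exact step hβ (ih hN)

/-! ### Applying a rule under a box -/

theorem boxStep_subset_of_future {N T : Set (Formula h P)} (hN : ∀ F ∈ N, future F ⊆ T)
    (i : Fin h) : boxStep i N ⊆ T := by
  rintro C (hC | ⟨hC, B, rfl⟩)
  · exact hN _ hC (by simp [future])
  · exact hN _ hC (by simp [future])

theorem boxStep_insert_box (i j : Fin h) (A : Formula h P) (N : Set (Formula h P)) :
    boxStep i (insert (.box j A) N) = boxStep i N := by
  ext C
  simp only [boxStep, Set.mem_union, Set.mem_ofPred_eq, Set.mem_insert_iff, reduceCtorEq, false_or]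
  grind

theorem SetProvable.box_family_of_saturated [NeZero h] {ι : Type*} {i : Fin h} {A : ι → Formula h P}
    {B : Formula h P} {N : Set (Formula h P)} {m : ℕ} (hN : ∀ F ∈ N, Saturated N F)
    (H : ∀ β : Ordinal.{v}, (∀ k, SetProvable β (insert (A k) (boxStep i N))) →
      SetProvable (β + (m : Ordinal)) (insert B (boxStep i N)))
    {β : Ordinal.{v}} (π : ∀ k, SetProvable β (insert (.box i (A k)) N)) :
    SetProvable (β + ((m + 1 : ℕ) : Ordinal)) (insert (.box i B) N) := by
  have hβ : β ≤ β + ((m + 1 : ℕ) : Ordinal) := le_self_add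
  -- If `N` alone is provable, weakening suffices. Otherwise no premise can be an axiom or end with
  -- a box formula of `N`, so every one comes from a box rule on its own □_i A_k.
  by_cases hB : SetProvable β N
  · exact (hB.weaken (Set.subset_insert _ _)).mono hβ
  · refine .box (Or.inl rfl) (lt_add_natCast_succ β m) ?_
    rw [boxStep_insert_box]
    refine H β fun k => ?_
    rcases (π k).cases_saturated (fun F hF => by
      rcases hF with rfl | hF
      · trivial
      · exact (hN F hF).mono (Set.subset_insert _ _)) with ⟨p, h₁, h₂⟩ | ⟨j, C, hC, β', hβ', ρ⟩
    · exact (hB (.ax (h₁.resolve_left (by simp)) (h₂.resolve_left (by simp)))).elim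
    · rw [boxStep_insert_box] at ρ
      rcases hC with e | hC
      · cases e
        exact ρ.mono hβ'.le
      · exact (hB (.box hC hβ' ρ)).elim

/-- `U` lists the formulas still to be decomposed and `n` bounds their total weight. Each local rule
costs one level and replaces a formula by a lighter worklist; `T` bounds what any branch can carry
through a box rule. -/
theorem SetProvable.box_family_of_worklist [NeZero h] {ι : Type*} {i : Fin h} {A : ι → Formula h P}
    {B : Formula h P} {X T : Set (Formula h P)} {m : ℕ}
    (H : ∀ Y : Set (Formula h P), Y ⊆ T → boxStep i X ⊆ Y → ∀ β : Ordinal.{v},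
      (∀ k, SetProvable β (insert (A k) Y)) → SetProvable (β + (m : Ordinal)) (insert B Y))
    (n : ℕ) (U : List (Formula h P)) (hU : (U.map weight).sum ≤ n) {N : Set (Formula h P)}
    (hX : X ⊆ N) (hT : ∀ F ∈ N, future F ⊆ T) (hN : ∀ F ∈ N, F ∈ U ∨ Saturated N F)
    (hUN : ∀ F ∈ U, F ∈ N)
    {β : Ordinal.{v}} (π : ∀ k, SetProvable β (insert (.box i (A k)) N)) :
    SetProvable (β + ((m + 1 + n : ℕ) : Ordinal)) (insert (.box i B) N) := by
  induction n generalizing U N with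
  | zero =>
    cases U with
    | nil =>
      exact SetProvable.box_family_of_saturated (fun F hF => (hN F hF).resolve_left (by simp))
        (H _ (boxStep_subset_of_future hT i) (boxStep_mono i hX)) π
    | cons F U =>
      have := weight_pos F
      simp only [List.map_cons, List.sum_cons] at hU
      omega
  | succ n ih =>
    have hlt := lt_add_natCast_succ β (m + 1 + n)
    cases U with
    | nil => exact (ih [] (by simp) hX hT hN hUN π).mono hlt.le
    | cons F U =>
      have hF := weight_pos F
      simp only [List.map_cons, List.sum_cons] at hU
      have hFN := hUN F (by simp)
      have hFT := hT F hFN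
      -- the general step: add `R` to the sequent and put `V` on the worklist instead of `F`
      have add : ∀ V : List (Formula h P), (V.map weight).sum < weight F →
          (∀ G ∈ V, future G ⊆ T) → Saturated ({G | G ∈ V} ∪ N) F →
          SetProvable (β + ((m + 1 + n : ℕ) : Ordinal))
            (insert (.box i B) ({G | G ∈ V} ∪ N)) := by
        intro V hV hVT hs
        refine ih (V ++ U) ?_ (hX.trans Set.subset_union_right) ?_ ?_ ?_ fun k =>
          (π k).weaken (Set.insert_subset_insert Set.subset_union_right)
        · simp only [List.map_append, List.sum_append]
          omega
        · rintro G (hG | hG)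
          · exact hVT G hG
          · exact hT G hG
        · rintro G (hG | hG)
          · exact Or.inl (List.mem_append_left _ hG)
          · rcases hN G hG with hG | hG
            · rcases List.mem_cons.1 hG with rfl | hG
              · exact Or.inr hs
              · exact Or.inl (List.mem_append_right _ hG)
            · exact Or.inr (hG.mono Set.subset_union_right)
        · intro G hG
          rcases List.mem_append.1 hG with hG | hG
          · exact Or.inl hG
          · exact Or.inr (hUN G (List.mem_cons_of_mem _ hG))
      have drop : Saturated N F → SetProvable (β + ((m + 1 + (n + 1) : ℕ) : Ordinal))
          (insert (.box i B) N) := fun hs =>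
        ((add [] (by simpa using hF) (by simp) (hs.mono Set.subset_union_right)).weaken
          (by simp)).mono hlt.le
      cases F with
      | and C D =>
        refine .and (Or.inr hFN) hlt ((add [C] ?_ ?_ ?_).weaken ?_) ((add [D] ?_ ?_ ?_).weaken ?_)
        · simp [weight]
        · simpa using Set.subset_union_left.trans hFT
        · simp [Saturated]
        · intro G; simp; grind
        · simp [weight]
        · simpa using Set.subset_union_right.trans hFT
        · simp [Saturated]
        · intro G; simp; grind
      | or C D =>
        refine .or (Or.inr hFN) hlt ((add [C, D] ?_ ?_ ?_).weaken ?_)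
        · simp [weight]
        · simpa using ⟨Set.subset_union_left.trans hFT, Set.subset_union_right.trans hFT⟩
        · simp [Saturated]
        · intro G; simp; grind
      | cbox C =>
        refine .cbox (fun _ => _) (Or.inr hFN) (fun _ => hlt) fun k =>
          (add [Formula.everyBox^[k + 1] C] ?_ ?_ ?_).weaken ?_
        · rw [Function.iterate_succ_apply']
          simpa [weight] using weight_everyBox _
        · rw [Function.iterate_succ_apply']
          simpa using (future_everyBox _).trans (Set.empty_subset T)
        · exact ⟨k, by simp⟩
        · intro G; simp only [List.mem_singleton]; simp; grind
      | cdia C =>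
        refine .cdia (Or.inr hFN) hlt ((add [Formula.everyDia C] ?_ ?_ ?_).weaken ?_)
        · simpa [weight] using weight_everyDia _
        · have : {C} ⊆ T := Set.Subset.trans (by simp [future]) hFT
          simpa using (future_everyDia _).trans this
        · simp [Saturated]
        · intro G; simp; grind
      | _ => exact drop trivial

/-- A rule with arbitrarily many premises, admissible at a finite cost, can be applied inside a
box at a finite cost. -/
theorem SetProvable.box_family [NeZero h] {ι : Type*} {i : Fin h} {A : ι → Formula h P}
    {B : Formula h P}
    {X : Set (Formula h P)} (hX : X.Finite)
    (H : ∀ Y : Set (Formula h P), Y.Finite → boxStep i X ⊆ Y → ∃ n : ℕ, ∀ β : Ordinal.{v},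
      (∀ k, SetProvable β (insert (A k) Y)) → SetProvable (β + (n : Ordinal)) (insert B Y)) :
    ∃ n : ℕ, ∀ β : Ordinal.{v}, (∀ k, SetProvable β (insert (.box i (A k)) X)) →
      SetProvable (β + (n : Ordinal)) (insert (.box i B) X) := by
  classical
  set T : Set (Formula h P) := ⋃ F ∈ X, future F with hT
  have fT : T.Finite := hX.biUnion fun F _ => finite_future F
  -- The hypotheses on `Y` are moved inside the existential, with default cost 0, so that a cost can
  -- be chosen for every set.
  have H' : ∀ Y : Set (Formula h P), ∃ n : ℕ, Y ⊆ T → boxStep i X ⊆ Y → ∀ β : Ordinal.{v},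
      (∀ k, SetProvable β (insert (A k) Y)) → SetProvable (β + (n : Ordinal)) (insert B Y) := by
    intro Y
    by_cases hY : Y ⊆ T ∧ boxStep i X ⊆ Y
    · exact (H Y (fT.subset hY.1) hY.2).imp fun n hn _ _ => hn
    · exact ⟨0, fun h₁ h₂ => (hY ⟨h₁, h₂⟩).elim⟩
  choose f hf using H'
  -- A single cost for all subsets of `T`, hence for all branches of the decomposition.
  obtain ⟨m, hm⟩ := (fT.finite_subsets.image f).bddAbove
  refine ⟨m + 1 + (hX.toFinset.toList.map weight).sum, fun β π => ?_⟩
  refine SetProvable.box_family_of_worklist (T := T) (m := m) (fun Y hY hXY γ ρ => ?_) _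
    hX.toFinset.toList le_rfl subset_rfl ?_ ?_ ?_ π
  · refine (hf Y hY hXY γ ρ).mono ?_
    gcongr
    exact hm ⟨Y, hY, rfl⟩
  · exact fun F hF => Set.subset_biUnion_of_mem (u := future) hF
  · intro F hF
    simp [hF]
  · simp

end CommonKnowledge

namespace CommonKnowledge

variable {h : ℕ} {P : Type u}

/-! ## Iterated diamonds below common knowledge -/

/-- Diamonds over ◇^k A act only at a box rule, which strips one of them; there ◇*A is still
available and can be unfolded to supply the ◇_j A needed to treat the next diamond. The cost depends
on k alone. -/
theorem SetProvable.of_range_dia [NeZero h] (A : Formula h P) (k : ℕ) : ∃ n : ℕ, ∀ (β : Ordinal.{v})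
    (N : Set (Formula h P)), .cdia A ∈ N → (∀ j, .dia j A ∈ N) →
      SetProvable β (Set.range (fun j => .dia j (Formula.everyDia^[k] A)) ∪ N) →
      SetProvable (β + (n : Ordinal)) N := by
  induction k with
  | zero =>
    refine ⟨0, fun β N _ hA π => ?_⟩
    simp only [Nat.cast_zero, add_zero]
    exact π.weaken (Set.union_subset (by rintro _ ⟨j, rfl⟩; exact hA j) subset_rfl)
  | succ k ihk =>
    obtain ⟨c, hc⟩ := ihk
    refine ⟨c + h + 1, fun β N hcA hA π => ?_⟩
    -- The induction on the derivation needs a variable as index; the inclusion is all that is used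
    -- of it.
    obtain ⟨N₀, hN₀⟩ : ∃ N₀, N₀ = Set.range (fun j : Fin h =>
      Formula.dia j (Formula.everyDia^[k + 1] A)) ∪ N := ⟨_, rfl⟩
    rw [← hN₀] at π
    replace hN₀ : N₀ ⊆ Set.range (fun j : Fin h =>
      Formula.dia j (Formula.everyDia^[k + 1] A)) ∪ N := hN₀.subset
    have lt : ∀ {β' β : Ordinal.{v}}, β' < β →
        β' + ((c + h + 1 : ℕ) : Ordinal) < β + ((c + h + 1 : ℕ) : Ordinal) := fun {β' β} hβ =>
      (lt_add_natCast_succ β' _).trans_le (add_natCast_le hβ _)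
    induction π generalizing N with
    | ax h₁ h₂ =>
      have h₁ := hN₀ h₁
      have h₂ := hN₀ h₂
      simp only [Set.mem_union, Set.mem_range, reduceCtorEq, exists_false, false_or] at h₁ h₂
      exact .ax h₁ h₂
    | and h₁ hβ _ _ ih₁ ih₂ =>
      have h₁ := hN₀ h₁
      simp only [Set.mem_union, Set.mem_range, reduceCtorEq, exists_false, false_or] at h₁
      exact .and h₁ (lt hβ) (ih₁ _ (by simp [hcA]) (by simp [hA]) (by grind))
        (ih₂ _ (by simp [hcA]) (by simp [hA]) (by grind))
    | or h₁ hβ _ ih =>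
      have h₁ := hN₀ h₁
      simp only [Set.mem_union, Set.mem_range, reduceCtorEq, exists_false, false_or] at h₁
      exact .or h₁ (lt hβ) (ih _ (by simp [hcA]) (by simp [hA]) (by grind))
    | cbox β' h₁ hβ _ ih =>
      have h₁ := hN₀ h₁
      simp only [Set.mem_union, Set.mem_range, reduceCtorEq, exists_false, false_or] at h₁
      exact .cbox _ h₁ (fun k => lt (hβ k)) fun k =>
        ih k _ (by simp [hcA]) (by simp [hA]) (by grind)
    | cdia h₁ hβ _ ih =>
      have h₁ := hN₀ h₁
      simp only [Set.mem_union, Set.mem_range, reduceCtorEq, exists_false, false_or] at h₁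
      exact .cdia h₁ (lt hβ) (ih _ (by simp [hcA]) (by simp [hA]) (by grind))
    -- The inner induction stops here, so the finite cost is paid once per branch: `c` for the case
    -- k, `h` to reassemble ◇A, and 1 to unfold ◇*A.
    | @box β β' N₀ i B h₁ hβ π =>
      have h₁ := hN₀ h₁
      simp only [Set.mem_union, Set.mem_range, reduceCtorEq, exists_false, false_or] at h₁
      have hcA' : Formula.cdia A ∈ boxStep i N := Or.inr ⟨hcA, _, rfl⟩
      have hA' : A ∈ boxStep i N := Or.inl (hA i)
      have π₁ : SetProvable β' (insert (Formula.everyDia^[k + 1] A) (insert B (boxStep i N))) := by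
        refine π.weaken ?_
        rintro F (rfl | hF)
        · exact Or.inr (Or.inl rfl)
        · rcases hF with hF | ⟨hF, C, rfl⟩
          · rcases hN₀ hF with ⟨j, e⟩ | hF
            · cases e
              exact Or.inl rfl
            · exact Or.inr (Or.inr (Or.inl hF))
          · rcases hN₀ hF with ⟨j, e⟩ | hF
            · cases e
            · exact Or.inr (Or.inr (Or.inr ⟨hF, C, rfl⟩))
      rw [Function.iterate_succ_apply'] at π₁
      have π₂ := hc β' (Set.range (fun j => Formula.dia j A) ∪ insert B (boxStep i N))
        (Or.inr (Or.inr hcA')) (fun j => Or.inl ⟨j, rfl⟩)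
        (π₁.of_everyDia.weaken (Set.union_subset_union_right _ Set.subset_union_right))
      refine .box h₁ (lt hβ) (SetProvable.cdia (A := A) (Or.inr hcA') ?_ π₂.everyDia)
      have := lt_add_natCast_succ β' (c + h)
      rwa [Nat.cast_add c h, ← add_assoc] at this

/-! ## Corresponding formulas of nested sequents -/

namespace NestedSequent

theorem formulas_add (Γ Δ : NestedSequent h P) : (Γ + Δ).formulas = Γ.formulas + Δ.formulas := by
  induction Γ using Quotient.inductionOn with | h Γ => ?_
  induction Δ using Quotient.inductionOn with | h Δ => ?_
  change (Γ.append Δ).formulas = Γ.formulas + Δ.formulas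
  induction Γ with
  | nil => simp [PreSequent.append, PreSequent.formulas]
  | formula A Γ ih => simp [PreSequent.append, PreSequent.formulas, ih]
  | boxed i Θ Γ _ ih => simp [PreSequent.append, PreSequent.formulas, ih]

theorem boxes_add (Γ Δ : NestedSequent h P) : (Γ + Δ).boxes = Γ.boxes + Δ.boxes := by
  induction Γ using Quotient.inductionOn with | h Γ => ?_
  induction Δ using Quotient.inductionOn with | h Δ => ?_
  change (Γ.append Δ).boxes = Γ.boxes + Δ.boxes
  induction Γ with
  | nil => simp [PreSequent.append, PreSequent.boxes]
  | formula A Γ ih => simp [PreSequent.append, PreSequent.boxes, ih]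
  | boxed i Θ Γ _ ih => simp [PreSequent.append, PreSequent.boxes, ih]

theorem formulas_ofFormula (A : Formula h P) : (ofFormula A).formulas = {A} := rfl

theorem boxes_ofFormula (A : Formula h P) : (ofFormula A).boxes = 0 := rfl

theorem formulas_box (i : Fin h) (Δ : NestedSequent h P) : (box i Δ).formulas = 0 := by
  induction Δ using Quotient.inductionOn with | h Δ => rfl

theorem boxes_box (i : Fin h) (Δ : NestedSequent h P) : (box i Δ).boxes = {⟨i, Δ⟩} := by
  induction Δ using Quotient.inductionOn with | h Δ => rfl

variable [LinearOrder (Formula h P)] [LinearOrder (BoxedSequent h P)]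

/-- The disjuncts of the corresponding formula. -/
def disjuncts (p : P) (Γ : NestedSequent h P) : List (Formula h P) :=
  Γ.formulas.sort (· ≤ ·) ++
    (Γ.boxes.sort (· ≤ ·)).map fun b => .box b.agent (b.content.toFormula p)

theorem toFormula_eq_disj (p : P) (Γ : NestedSequent h P) :
    Γ.toFormula p = Formula.disj p (Γ.disjuncts p) :=
  Γ.toFormula_eq p

/-- The set of disjuncts of the corresponding formula. -/
def toSet (p : P) (Γ : NestedSequent h P) : Set (Formula h P) := {F | F ∈ Γ.disjuncts p}

theorem mem_toSet {p : P} {Γ : NestedSequent h P} {F : Formula h P} : F ∈ Γ.toSet p ↔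
    F ∈ Γ.formulas ∨ ∃ b ∈ Γ.boxes, .box b.agent (b.content.toFormula p) = F := by
  simp [toSet, disjuncts]

theorem finite_toSet (p : P) (Γ : NestedSequent h P) : (Γ.toSet p).Finite :=
  List.finite_toSet _

theorem toSet_add (p : P) (Γ Δ : NestedSequent h P) :
    (Γ + Δ).toSet p = Γ.toSet p ∪ Δ.toSet p := by
  ext F
  simp only [Set.mem_union, mem_toSet, formulas_add, boxes_add, Multiset.mem_add]
  grind

theorem toSet_ofFormula (p : P) (A : Formula h P) : (ofFormula A).toSet p = {A} := by
  ext F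
  simp [mem_toSet, formulas_ofFormula, boxes_ofFormula]

theorem toSet_box (p : P) (i : Fin h) (Δ : NestedSequent h P) :
    (box i Δ).toSet p = {.box i (Δ.toFormula p)} := by
  ext F
  simp [mem_toSet, formulas_box, boxes_box, eq_comm]

theorem toFormula_ofFormula (p : P) (A : Formula h P) : (ofFormula A).toFormula p = A := by
  rw [toFormula_eq]
  simp [formulas_ofFormula, boxes_ofFormula, Formula.disj]

theorem of_toFormula [NeZero h] {p : P} {β : Ordinal.{v}} {Γ : NestedSequent h P} {N : Set
    (Formula h P)}
    (hΓ : (Γ.toSet p).Nonempty) (π : SetProvable β (insert (Γ.toFormula p) N)) :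
    SetProvable β (Γ.toSet p ∪ N) := by
  rw [toFormula_eq_disj] at π
  exact π.of_disj (List.ne_nil_of_mem hΓ.some_mem)

theorem to_toFormula [NeZero h] (p : P) {β : Ordinal.{v}} (Γ : NestedSequent h P) {N : Set
    (Formula h P)}
    (π : SetProvable β (Γ.toSet p ∪ N)) :
    SetProvable (β + ((Γ.disjuncts p).length : Ordinal)) (insert (Γ.toFormula p) N) := by
  rw [toFormula_eq_disj]
  exact π.disj p

end NestedSequent

/-! ## Deep rules are admissible at a finite cost -/

/-- In every finite set of side formulas, the rule with premises `𝒜 k` and conclusion `ℬ` is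
admissible at the cost of a finite increase in depth. -/
def FinitelyAdmissible [NeZero h] {ι : Type} (𝒜 : ι → Set (Formula h P)) (ℬ : Set
    (Formula h P)) : Prop :=
  ∀ X : Set (Formula h P), X.Finite → ∃ n : ℕ, ∀ β : Ordinal.{v},
    (∀ k, SetProvable β (𝒜 k ∪ X)) → SetProvable (β + (n : Ordinal)) (ℬ ∪ X)

theorem FinitelyAdmissible.add [NeZero h] {ι : Type} {𝒜 : ι → Set (Formula h P)} {ℬ : Set
    (Formula h P)}
    (H : FinitelyAdmissible.{u, v} 𝒜 ℬ) {Y : Set (Formula h P)} (hY : Y.Finite) :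
    FinitelyAdmissible.{u, v} (fun k => Y ∪ 𝒜 k) (Y ∪ ℬ) := by
  intro X hX
  obtain ⟨n, hn⟩ := H (Y ∪ X) (hY.union hX)
  refine ⟨n, fun β π => (hn β fun k => (π k).weaken ?_).weaken ?_⟩ <;> grind

theorem finitelyAdmissible_cdia [NeZero h] (A : Formula h P) (k : ℕ) :
    FinitelyAdmissible.{u, v} (fun _ : Unit => {.cdia A} ∪ {Formula.everyDia^[k + 1] A})
      {.cdia A} := by
  intro X _
  obtain ⟨n, hn⟩ := SetProvable.of_range_dia.{u, v} A k
  refine ⟨n + h + 1, fun β π => ?_⟩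
  have π₁ : SetProvable β (insert (Formula.everyDia^[k + 1] A) ({.cdia A} ∪ X)) :=
    (π ()).weaken (by grind)
  rw [Function.iterate_succ_apply'] at π₁
  have π₂ := hn β (Set.range (fun j => Formula.dia j A) ∪ ({.cdia A} ∪ X)) (Or.inr (Or.inl rfl))
    (fun j => Or.inl ⟨j, rfl⟩)
    (π₁.of_everyDia.weaken (Set.union_subset_union_right _ Set.subset_union_right))
  refine SetProvable.cdia (A := A) (Or.inl rfl) ?_ π₂.everyDia
  have := lt_add_natCast_succ β (n + h)
  rwa [Nat.cast_add n h, ← add_assoc] at this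

/-- The surplus m may vary with the premise without bound, but each ω·γ + m stays below ω·(γ+1) ≤
ω·δ, so all premises share the bound ω·δ. -/
theorem FinitelyAdmissible.setProvable [NeZero h] {ι : Type} {𝒜 : ι → Set (Formula h P)}
    {ℬ : Set (Formula h P)} (H : FinitelyAdmissible.{u, v} 𝒜 ℬ) {δ : Ordinal.{v}}
    (π : ∀ k, ∃ γ < δ, ∃ n : ℕ, SetProvable (ω * γ + (n : Ordinal)) (𝒜 k)) :
    ∃ n : ℕ, SetProvable (ω * δ + (n : Ordinal)) ℬ := by
  obtain ⟨n, hn⟩ := H ∅ Set.finite_empty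
  refine ⟨n, (hn _ fun k => ?_).weaken (by simp)⟩
  obtain ⟨γ, hγ, m, ρ⟩ := π k
  refine (ρ.mono ?_).weaken (by simp)
  calc ω * γ + (m : Ordinal) ≤ ω * γ + ω := by gcongr; exact (natCast_lt_omega0 m).le
    _ = ω * Order.succ γ := (mul_succ _ _).symm
    _ ≤ ω * δ := by gcongr; exact Order.succ_le_of_lt hγ

open NestedSequent

variable [LinearOrder (Formula h P)] [LinearOrder (BoxedSequent h P)]

/-- Induction on the context, one use of `SetProvable.box_family` per box around the hole.
Nonemptiness of the premises ensures that their corresponding formulas are genuine disjunctions, not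
the default ⊥. -/
theorem FinitelyAdmissible.fill [NeZero h] {ι : Type} {p : P} {𝒜 : ι → NestedSequent h P}
    {ℬ : NestedSequent h P} (H : FinitelyAdmissible.{u, v} (fun k => (𝒜 k).toSet p) (ℬ.toSet p))
    (h𝒜 : ∀ k, ((𝒜 k).toSet p).Nonempty) (C : Context h P) :
    FinitelyAdmissible.{u, v} (fun k => (C.fill (𝒜 k)).toSet p) ((C.fill ℬ).toSet p) := by
  induction C with
  | hole Δ =>
    simp only [Context.fill, toSet_add]
    exact H.add (finite_toSet p Δ)
  | boxed Δ i C ih =>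
    simp only [Context.fill, toSet_add, toSet_box]
    refine FinitelyAdmissible.add (fun X hX => ?_) (finite_toSet p Δ)
    refine SetProvable.box_family hX fun Y hY _ => ?_
    obtain ⟨n, hn⟩ := ih Y hY
    refine ⟨n + ((C.fill ℬ).disjuncts p).length, fun β π => ?_⟩
    rw [Nat.cast_add, ← add_assoc]
    refine to_toFormula p _ (hn β fun k => of_toFormula ?_ (π k))
    have : ∀ (C : Context h P), ((C.fill (𝒜 k)).toSet p).Nonempty := by
      intro C
      cases C with
      | hole Δ => exact (h𝒜 k).mono (by simp [Context.fill, toSet_add])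
      | boxed Δ i C => exact ⟨_, by rw [Context.fill, toSet_add, toSet_box]; exact Or.inr rfl⟩
    exact this C

theorem finitelyAdmissible_dia [NeZero h] (p : P) (i : Fin h) (A : Formula h P)
    (Δ : NestedSequent h P) :
    FinitelyAdmissible.{u, v}
      (fun _ : Unit => (ofFormula (.dia i A) + box i (Δ + ofFormula A)).toSet p)
      ((ofFormula (.dia i A) + box i Δ).toSet p) := by
  simp only [toSet_add, toSet_box, toSet_ofFormula]
  intro X hX
  obtain ⟨n, hn⟩ := SetProvable.box_family.{u, v} (ι := Unit) (i := i)
    (A := fun _ => (Δ + ofFormula A).toFormula p) (B := Δ.toFormula p) (X := insert (.dia i A) X)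
    (hX.insert _) (fun Y _ hXY => by
      -- With ◇_i A among the side formulas, the box rule for agent i already delivers A, so the
      -- extra disjunct A merges with `Y`.
      have hA : A ∈ Y := hXY (Or.inl (Or.inl rfl))
      refine ⟨(Δ.disjuncts p).length, fun β π => to_toFormula p _
        ((of_toFormula ⟨A, ?_⟩ (π ())).weaken ?_)⟩
      · rw [toSet_add, toSet_ofFormula]
        exact Or.inr rfl
      · rw [toSet_add, toSet_ofFormula]
        grind)
  refine ⟨n, fun β π => (hn β fun k => (π k).weaken ?_).weaken ?_⟩ <;> grind

theorem DeepProof.setProvable [NeZero h] (p : P) {Γ : NestedSequent h P} (π : DeepProof Γ) :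
    ∃ n : ℕ, SetProvable (ω * π.depth.{u, v} + (n : Ordinal)) (Γ.toSet p) := by
  induction π with
  | ax C q =>
    -- An axiom is treated as a rule without premises.
    refine (FinitelyAdmissible.fill (ι := Empty) (𝒜 := Empty.elim) (fun X _ => ⟨0, fun β _ => ?_⟩)
      (fun k => k.elim) C).setProvable fun k => k.elim
    rw [toSet_add, toSet_ofFormula, toSet_ofFormula]
    exact .ax (p := q) (by simp) (by simp)
  | and C A B π₁ π₂ ih₁ ih₂ =>
    refine (FinitelyAdmissible.fill (ι := Bool)
      (𝒜 := fun b => bif b then ofFormula A else ofFormula B)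
      (fun X _ => ⟨1, fun β π => ?_⟩) ?_ C).setProvable ?_
    · have π₁ := π true
      have π₂ := π false
      simp only [cond_true, cond_false, toSet_ofFormula] at π₁ π₂ ⊢
      exact .and (A := A) (B := B) (Or.inl rfl) (by simp) (π₁.weaken (by grind))
        (π₂.weaken (by grind))
    · rintro (_ | _) <;> simp [toSet_ofFormula]
    · rintro (_ | _)
      · exact ⟨_, by simp [DeepProof.depth], ih₂⟩
      · exact ⟨_, by simp [DeepProof.depth], ih₁⟩
  | or C A B π ih =>
    refine (FinitelyAdmissible.fill (ι := Unit) (𝒜 := fun _ => ofFormula A + ofFormula B)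
      (fun X _ => ⟨1, fun β π => ?_⟩) ?_ C).setProvable fun _ => ⟨_, Order.lt_succ _, ih⟩
    · have π := π ()
      simp only [toSet_add, toSet_ofFormula] at π ⊢
      exact .or (A := A) (B := B) (Or.inl rfl) (by simp) (π.weaken (by grind))
    · simp [toSet_add, toSet_ofFormula]
  | box C i A π ih =>
    -- No cost at all: [A]_i and □_i A have the same corresponding formula.
    refine (FinitelyAdmissible.fill (ι := Unit) (𝒜 := fun _ => NestedSequent.box i (ofFormula A))
      (fun X _ => ⟨0, fun β π => ?_⟩) ?_ C).setProvable fun _ => ⟨_, Order.lt_succ _, ih⟩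
    · simpa [toSet_box, toFormula_ofFormula, toSet_ofFormula] using π ()
    · simp [toSet_box]
  | dia C i A Δ π ih =>
    refine ((finitelyAdmissible_dia p i A Δ).fill ?_ C).setProvable
      fun _ => ⟨_, Order.lt_succ _, ih⟩
    simp [toSet_add, toSet_ofFormula]
  | cbox C A π ih =>
    refine (FinitelyAdmissible.fill (ι := ℕ)
      (𝒜 := fun k => ofFormula (Formula.everyBox^[k + 1] A))
      (fun X _ => ⟨1, fun β π => ?_⟩) ?_ C).setProvable fun k => ⟨_, ?_, ih k⟩
    · simp only [toSet_ofFormula] at π ⊢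
      exact .cbox (fun _ => β) (A := A) (Or.inl rfl) (by simp) fun k => (π k).weaken (by grind)
    · simp [toSet_ofFormula]
    · rw [DeepProof.depth]
      exact (Order.lt_succ _).trans_le
        (Ordinal.le_iSup (fun k => Order.succ ((π k).depth : Ordinal.{v})) k)
  | cdia C A k π ih =>
    refine (FinitelyAdmissible.fill (ι := Unit)
      (𝒜 := fun _ => ofFormula (.cdia A) + ofFormula (Formula.everyDia^[k + 1] A))
      ?_ ?_ C).setProvable fun _ => ⟨_, Order.lt_succ _, ih⟩
    · simp only [toSet_add, toSet_ofFormula]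
      exact finitelyAdmissible_cdia A k
    · simp [toSet_add, toSet_ofFormula]

end CommonKnowledge

theorem mainTheorem9 {h : ℕ} [NeZero h] {P : Type u}
    [LinearOrder (CommonKnowledge.Formula h P)] [LinearOrder (CommonKnowledge.BoxedSequent h P)]
    (p : P) (α : Ordinal.{v}) (Γ : CommonKnowledge.NestedSequent h P)
    (hΓ : CommonKnowledge.DeepProvable α Γ) :
    CommonKnowledge.ShallowProvable (ω * (α + 1)) {Γ.toFormula p} := by
  obtain ⟨π, hπ⟩ := hΓ
  obtain ⟨n, ρ⟩ := π.setProvable p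
  refine ((CommonKnowledge.NestedSequent.to_toFormula p Γ (N := ∅)
    (ρ.weaken (by simp))).mono ?_).shallowProvable (by simp)
  rw [add_assoc, ← Nat.cast_add, mul_add, mul_one]
  gcongr
  exact (natCast_lt_omega0 _).le
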